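/- Let $N\ge 1$ and let $\mathscr{K}$ be a nonempty finite set of nonnegative real $N\times N$ matrices with the product property: for all $A,B\in\mathscr{K}$ and every $V\subseteq\{1,\dots,N\}$, the matrix whose $i$-th row is the $i$-th row of $A$ if $i\in V$ and the $i$-th row of $B$ if $i\notin V$ belongs to $\mathscr{K}$. Define $f_{\mathscr{K}}:\mathbb{R}^N\to\mathbb{R}^N$ by $f_{\mathscr{K}}(v)=\min_{A\in\mathscr{K}}Av$, where the minimum is taken componentwise, and let $\mathrm{spr}(A)$ denote the spectral radius of $A$. Suppose that every $A\in\mathscr{K}$ is irreducible, i.e. for all $i,j$ there is an integer $n\ge 0$ with $(A^n)_{ij}>0$. Put $\lambda_{\mathscr{K}}=\min_{A\in\mathscr{K}}\mathrm{spr}(A)$. Then there is a vector $v\in\mathbb{R}^N$ with all components strictly positive such that $f_{\mathscr{K}}(v)=\lambda_{\mathscr{K}}v$. Moreover, the eigenvector of $f_{\mathscr{K}}$ associated with $\lambda_{\mathscr{K}}$ is unique up to a scalar multiple: every $u\in\mathbb{R}^N$ with $f_{\mathscr{K}}(u)=\lambda_{\mathscr{K}}u$ is of the form $u=cv$ with $c\in\mathbb{R}$.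 -/

import Mathlib

open scoped Matrix

namespace MinMatrix

/-- A real matrix is nonnegative if all its entries are nonnegative. -/
def IsNonneg {N : ℕ} (A : Matrix (Fin N) (Fin N) ℝ) : Prop :=
  ∀ i j, 0 ≤ A i j

/-- State `i` has access to state `j` if some power `A ^ n`, `n ≥ 0`, has a positive `(i, j)` entry. -/
def HasAccess {N : ℕ} (A : Matrix (Fin N) (Fin N) ℝ) (i j : Fin N) : Prop :=
  ∃ n : ℕ, 0 < (A ^ n) i j

/-- Any two states have access to each other. Since the exponent `0` is allowed, the `1 × 1` zero
matrix is irreducible, unlike in `Matrix.IsIrreducible`; for nonnegative matrices the two notions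
differ only there. -/
def Irreducible {N : ℕ} (A : Matrix (Fin N) (Fin N) ℝ) : Prop :=
  ∀ i j, HasAccess A i j

/-- The spectral radius of a real matrix: the largest modulus of its complex eigenvalues. -/
noncomputable def spr {N : ℕ} (A : Matrix (Fin N) (Fin N) ℝ) : ℝ :=
  (spectralRadius ℂ (A.map (algebraMap ℝ ℂ))).toReal

/-- The product property: `K` is closed under interchanging corresponding rows of its members. -/
def ProductProperty {N : ℕ} (K : Finset (Matrix (Fin N) (Fin N) ℝ)) : Prop :=
  ∀ V : Finset (Fin N), ∀ A ∈ K, ∀ B ∈ K,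
    (Matrix.of fun i => if i ∈ V then A i else B i) ∈ K

/-- The map `v ↦ min_{A ∈ K} A v`, with the minimum taken componentwise. -/
noncomputable def minMap {N : ℕ} (K : Finset (Matrix (Fin N) (Fin N) ℝ)) (hK : K.Nonempty)
    (v : Fin N → ℝ) : Fin N → ℝ :=
  fun i => K.inf' hK fun A => (A *ᵥ v) i

end MinMatrix

/-!
The theorem follows from Perron–Frobenius theory, of which only a small part is needed.

*Perron vectors.* For an irreducible nonnegative matrix `A`, let `r` be the largest `t` for which
some nonzero `x ≥ 0` satisfies `t x ≤ A x`; it exists by compactness of the simplex. A maximizing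
`x` satisfies `A x = r x`: otherwise a positive matrix `P` commuting with `A` would make
`A (P x) - r P x` positive, so that `r` could be increased. Taking moduli in a complex eigenvalue
equation `A z = μ z` gives `|μ| |z| ≤ A |z|`, hence `|μ| ≤ r`, and so `r` is the spectral radius
(`exists_pos_eigenvector`).

*Rigidity.* If `A z ≤ r z` with `A` irreducible, `z ≥ 0`, `r ≥ 0` and `z` vanishes at one index,
then `z = 0` (`eq_zero_of_mulVec_le`). Applied to `z = c v - u` with the least `c` making `z ≥ 0`,
this shows that, if `A v ≤ r v` with `v > 0`, every `u` with `r u ≤ A u` is a multiple of `v`,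
provided that `u ≥ 0` (which makes `c ≥ 0`) or that `A v = r v`.

*Conclusion.* Let `v` be the Perron vector of a matrix in `K` of least spectral radius `r`. By the
product property the minimum at `v` is attained by a single `B ∈ K`, so `B v ≤ r v`. The Perron
vector `w` of `B` satisfies `B w = spr B w ≥ r w`, so it is a multiple of `v` by rigidity, whence
`B v = r v`. A further eigenvector `u` of the minimum map satisfies `B u ≥ r u`, and rigidity for
`B` makes `u` a multiple of `v`.
-/

namespace MinMatrix

variable {N : ℕ} {A : Matrix (Fin N) (Fin N) ℝ}

theorem IsNonneg.mulVec_nonneg (hA : IsNonneg A) {x : Fin N → ℝ} (hx : 0 ≤ x) : 0 ≤ A *ᵥ x := by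
  intro i
  simp only [Matrix.mulVec, dotProduct]
  exact Finset.sum_nonneg fun j _ => mul_nonneg (hA i j) (hx j)

theorem IsNonneg.mulVec_mono (hA : IsNonneg A) {x y : Fin N → ℝ} (hxy : x ≤ y) :
    A *ᵥ x ≤ A *ᵥ y := by
  intro i
  simp only [Matrix.mulVec, dotProduct]
  exact Finset.sum_le_sum fun j _ => mul_le_mul_of_nonneg_left (hxy j) (hA i j)

theorem IsNonneg.pow (hA : IsNonneg A) (n : ℕ) : IsNonneg (A ^ n) := by
  induction n with
  | zero =>
    intro i j
    rw [pow_zero, Matrix.one_apply]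
    split_ifs <;> norm_num
  | succ n ih =>
    intro i j
    rw [pow_succ, Matrix.mul_apply]
    exact Finset.sum_nonneg fun k _ => mul_nonneg (ih i k) (hA k j)

theorem IsNonneg.pow_mulVec_le (hA : IsNonneg A) {r : ℝ} (hr : 0 ≤ r) {z : Fin N → ℝ}
    (h : A *ᵥ z ≤ r • z) (n : ℕ) : (A ^ n) *ᵥ z ≤ r ^ n • z := by
  induction n with
  | zero => simp
  | succ n ih =>
    calc (A ^ (n + 1)) *ᵥ z = A *ᵥ ((A ^ n) *ᵥ z) := by
          rw [pow_succ', Matrix.mulVec_mulVec]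
      _ ≤ A *ᵥ (r ^ n • z) := hA.mulVec_mono ih
      _ = r ^ n • (A *ᵥ z) := Matrix.mulVec_smul _ _ _
      _ ≤ r ^ n • (r • z) := smul_le_smul_of_nonneg_left h (pow_nonneg hr n)
      _ = r ^ (n + 1) • z := by rw [smul_smul, pow_succ]

/-- A nonnegative subinvariant vector of an irreducible matrix is zero or positive. -/
theorem eq_zero_of_mulVec_le (hA : IsNonneg A) (hirr : Irreducible A) {r : ℝ} (hr : 0 ≤ r)
    {z : Fin N → ℝ} (hz : 0 ≤ z) (h : A *ᵥ z ≤ r • z) {i : Fin N} (hi : z i = 0) : z = 0 := by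
  funext j
  obtain ⟨n, hn⟩ := hirr i j
  have h1 : (A ^ n *ᵥ z) i ≤ 0 := by simpa [hi] using hA.pow_mulVec_le hr h n i
  have h2 : (A ^ n) i j * z j ≤ (A ^ n *ᵥ z) i :=
    Finset.single_le_sum (f := fun k => (A ^ n) i k * z k)
      (fun k _ => mul_nonneg (hA.pow n i k) (hz k)) (Finset.mem_univ j)
  exact le_antisymm (nonpos_of_mul_nonpos_right (h2.trans h1) hn) (hz j)

/-- The least multiple of a positive vector that dominates a given vector touches it somewhere. -/
theorem exists_le_smul_and_eq [NeZero N] (u : Fin N → ℝ) {v : Fin N → ℝ} (hv : ∀ i, 0 < v i) :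
    ∃ (c : ℝ) (i : Fin N), u ≤ c • v ∧ u i = c * v i := by
  obtain ⟨i, hi⟩ := Finite.exists_max fun j => u j / v j
  refine ⟨u i / v i, i, fun j => ?_, (div_mul_cancel₀ _ (hv i).ne').symm⟩
  exact (div_le_iff₀ (hv j)).1 (hi j)

/-- If an irreducible matrix has a positive subinvariant vector `v`, then every nonnegative
superinvariant vector for the same number `r` is a multiple of `v`. -/
theorem eq_smul_of_mulVec_le [NeZero N] (hA : IsNonneg A) (hirr : Irreducible A) {r : ℝ}
    (hr : 0 ≤ r) {u v : Fin N → ℝ} (hv : ∀ i, 0 < v i) (hAv : A *ᵥ v ≤ r • v)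
    (hu : 0 ≤ u) (hAu : r • u ≤ A *ᵥ u) : ∃ c : ℝ, u = c • v := by
  obtain ⟨c, i, hle, hi⟩ := exists_le_smul_and_eq u hv
  have hc : 0 ≤ c := nonneg_of_mul_nonneg_left (hi ▸ hu i) (hv i)
  have hz : c • v - u = 0 := by
    refine eq_zero_of_mulVec_le hA hirr hr (sub_nonneg.2 hle) ?_ (i := i) (by simp [hi])
    rw [Matrix.mulVec_sub, Matrix.mulVec_smul, smul_sub, smul_comm r c]
    exact sub_le_sub (smul_le_smul_of_nonneg_left hAv hc) hAu
  exact ⟨c, (sub_eq_zero.1 hz).symm⟩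

/-- If an irreducible matrix has a positive eigenvector `v`, then every superinvariant vector for
the same eigenvalue, of whatever sign, is a multiple of `v`. -/
theorem eq_smul_of_mulVec_eq [NeZero N] (hA : IsNonneg A) (hirr : Irreducible A) {r : ℝ}
    (hr : 0 ≤ r) {u v : Fin N → ℝ} (hv : ∀ i, 0 < v i) (hAv : A *ᵥ v = r • v)
    (hAu : r • u ≤ A *ᵥ u) : ∃ c : ℝ, u = c • v := by
  obtain ⟨c, i, hle, hi⟩ := exists_le_smul_and_eq u hv
  have hz : c • v - u = 0 := by
    refine eq_zero_of_mulVec_le hA hirr hr (sub_nonneg.2 hle) ?_ (i := i) (by simp [hi])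
    rw [Matrix.mulVec_sub, Matrix.mulVec_smul, smul_sub, smul_comm r c, hAv]
    exact sub_le_sub_left hAu _
  exact ⟨c, (sub_eq_zero.1 hz).symm⟩

/-- The sum of suitable powers of an irreducible matrix is a positive matrix commuting with it. -/
theorem exists_commute_pos (hA : IsNonneg A) (hirr : Irreducible A) :
    ∃ P : Matrix (Fin N) (Fin N) ℝ, Commute P A ∧ ∀ i j, 0 < P i j := by
  choose n hn using hirr
  refine ⟨∑ p : Fin N × Fin N, A ^ n p.1 p.2,
    Commute.sum_left _ _ _ fun p _ => Commute.pow_self A _, fun i j => ?_⟩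
  rw [Matrix.sum_apply]
  exact Finset.sum_pos' (fun p _ => hA.pow _ i j) ⟨(i, j), Finset.mem_univ _, hn i j⟩

/-- There is a largest `r` for which some vector of the simplex satisfies `r • x ≤ A *ᵥ x`
(the Collatz–Wielandt number of `A`). -/
theorem exists_max_superinvariant [NeZero N] (hA : IsNonneg A) :
    ∃ (r : ℝ) (x : Fin N → ℝ), 0 ≤ r ∧ 0 ≤ x ∧ x ≠ 0 ∧ r • x ≤ A *ᵥ x ∧
      ∀ (t : ℝ) (y : Fin N → ℝ), 0 ≤ y → y ≠ 0 → t • y ≤ A *ᵥ y → t ≤ r := by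
  -- On the simplex, summing the components of `t x ≤ A x` bounds `t` by the sum of all entries.
  let M : ℝ := ∑ i, ∑ j, A i j
  have bound : ∀ (t : ℝ) (x : Fin N → ℝ), x ∈ stdSimplex ℝ (Fin N) → t • x ≤ A *ᵥ x → t ≤ M := by
    intro t x hx h
    calc t = ∑ i, (t • x) i := by simp [← Finset.mul_sum, hx.2]
      _ ≤ ∑ i, (A *ᵥ x) i := Finset.sum_le_sum fun i _ => h i
      _ ≤ M := Finset.sum_le_sum fun i _ => by
          simp only [Matrix.mulVec, dotProduct]
          exact Finset.sum_le_sum fun j _ => mul_le_of_le_one_right (hA i j)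
            ((mem_Icc_of_mem_stdSimplex hx j).2)
  let S : Set (ℝ × (Fin N → ℝ)) :=
    (Set.Icc 0 M ×ˢ stdSimplex ℝ (Fin N)) ∩ {p | p.1 • p.2 ≤ A *ᵥ p.2}
  have hS : IsCompact S := by
    refine (isCompact_Icc.prod (isCompact_stdSimplex ℝ (Fin N))).inter_right ?_
    exact isClosed_le (by fun_prop) (by fun_prop)
  have hM0 : 0 ≤ M := Finset.sum_nonneg fun i _ => Finset.sum_nonneg fun j _ => hA i j
  have hne : S.Nonempty := by
    refine ⟨(0, Pi.single 0 1), ⟨⟨le_rfl, hM0⟩, single_mem_stdSimplex ℝ 0⟩, ?_⟩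
    have h0 : (0 : Fin N → ℝ) ≤ Pi.single 0 1 := (single_mem_stdSimplex ℝ (0 : Fin N)).1
    simpa using hA.mulVec_nonneg h0
  obtain ⟨⟨r, x⟩, ⟨⟨hr, hx⟩, hle⟩, hmax⟩ := hS.exists_isMaxOn hne continuous_fst.continuousOn
  refine ⟨r, x, hr.1, hx.1, ?_, hle, fun t y hy hy0 hty => ?_⟩
  · rintro rfl
    simpa using hx.2
  rcases le_total t 0 with ht | ht
  · exact ht.trans hr.1
  have hs : 0 < ∑ i, y i := by
    refine (Finset.sum_nonneg fun i _ => hy i).lt_of_ne' fun h => hy0 ?_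
    funext i
    exact (Finset.sum_eq_zero_iff_of_nonneg fun i _ => hy i).1 h i (Finset.mem_univ i)
  have hmem : (∑ i, y i)⁻¹ • y ∈ stdSimplex ℝ (Fin N) := by
    refine ⟨fun i => mul_nonneg (inv_nonneg.2 hs.le) (hy i), ?_⟩
    simp [← Finset.mul_sum, hs.ne']
  have hty' : t • ((∑ i, y i)⁻¹ • y) ≤ A *ᵥ ((∑ i, y i)⁻¹ • y) := by
    rw [Matrix.mulVec_smul, smul_comm]
    exact smul_le_smul_of_nonneg_left hty (inv_nonneg.2 hs.le)
  exact hmax (a := (t, (∑ i, y i)⁻¹ • y)) ⟨⟨⟨ht, bound _ _ hmem hty'⟩, hmem⟩, hty'⟩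

theorem mulVec_pos_of_pos {P : Matrix (Fin N) (Fin N) ℝ} (hP : ∀ i j, 0 < P i j)
    {x : Fin N → ℝ} (hx : 0 ≤ x) (hx0 : x ≠ 0) (i : Fin N) : 0 < (P *ᵥ x) i := by
  obtain ⟨j, hj⟩ := Function.ne_iff.1 hx0
  exact Finset.sum_pos' (fun k _ => mul_nonneg (hP i k).le (hx k))
    ⟨j, Finset.mem_univ j, mul_pos (hP i j) ((hx j).lt_of_ne' hj)⟩

/-- The complex spectral radius is `r` as soon as `r` is an eigenvalue and is an upper bound for
the `t` that have a nonzero nonnegative vector `y` with `t • y ≤ A *ᵥ y`. -/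
theorem spr_eq_of_max (hA : IsNonneg A) {r : ℝ} (hr : 0 ≤ r) {x : Fin N → ℝ} (hx0 : x ≠ 0)
    (hx : A *ᵥ x = r • x)
    (hmax : ∀ (t : ℝ) (y : Fin N → ℝ), 0 ≤ y → y ≠ 0 → t • y ≤ A *ᵥ y → t ≤ r) :
    spr A = r := by
  have key : spectralRadius ℂ (A.map (algebraMap ℝ ℂ)) = ENNReal.ofReal r := by
    apply le_antisymm
    · refine iSup₂_le fun μ hμ => ?_
      rw [← Matrix.spectrum_toLin', ← Module.End.hasEigenvalue_iff_mem_spectrum] at hμ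
      obtain ⟨z, hz⟩ := hμ.exists_hasEigenvector
      have hzeq : A.map (algebraMap ℝ ℂ) *ᵥ z = μ • z := by
        simpa using hz.apply_eq_smul
      have hle : ‖μ‖ ≤ r := by
        refine hmax ‖μ‖ (fun i => ‖z i‖) (fun i => norm_nonneg _) (fun h => hz.2 ?_) fun i => ?_
        · funext i
          exact norm_eq_zero.1 (congrFun h i)
        · calc ‖μ‖ * ‖z i‖ = ‖(A.map (algebraMap ℝ ℂ) *ᵥ z) i‖ := by
                rw [hzeq, Pi.smul_apply, norm_smul]
            _ ≤ ∑ j, ‖A.map (algebraMap ℝ ℂ) i j * z j‖ := by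
                simp only [Matrix.mulVec, dotProduct]
                exact norm_sum_le _ _
            _ = ∑ j, A i j * ‖z j‖ := by
                refine Finset.sum_congr rfl fun j _ => ?_
                rw [norm_mul, Matrix.map_apply, norm_algebraMap', Real.norm_of_nonneg (hA i j)]
      rw [← enorm_eq_nnnorm, ← ofReal_norm]
      exact ENNReal.ofReal_le_ofReal hle
    · have hmem : (r : ℂ) ∈ spectrum ℂ (A.map (algebraMap ℝ ℂ)) := by
        rw [← Matrix.spectrum_toLin', ← Module.End.hasEigenvalue_iff_mem_spectrum]
        refine Module.End.hasEigenvalue_of_hasEigenvector (x := fun i => (x i : ℂ))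
          ⟨Module.End.mem_eigenspace_iff.2 ?_, fun h => hx0 ?_⟩
        · funext i
          have := congrArg (algebraMap ℝ ℂ) (congrFun hx i)
          simpa [Matrix.mulVec, dotProduct] using this
        · funext i
          exact Complex.ofReal_eq_zero.1 (congrFun h i)
      calc ENNReal.ofReal r = ‖(r : ℂ)‖₊ := by
            rw [← enorm_eq_nnnorm, ← ofReal_norm, Complex.norm_of_nonneg hr]
        _ ≤ _ := le_iSup₂ (f := fun (k : ℂ) (_ : k ∈ spectrum ℂ (A.map (algebraMap ℝ ℂ))) =>
            (‖k‖₊ : ENNReal)) (r : ℂ) hmem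
  rw [spr, key, ENNReal.toReal_ofReal hr]

theorem spr_nonneg (A : Matrix (Fin N) (Fin N) ℝ) : 0 ≤ spr A := ENNReal.toReal_nonneg

/-- **Perron–Frobenius**: an irreducible nonnegative matrix has a positive eigenvector for its
spectral radius. -/
theorem exists_pos_eigenvector [NeZero N] (hA : IsNonneg A) (hirr : Irreducible A) :
    ∃ v : Fin N → ℝ, (∀ i, 0 < v i) ∧ A *ᵥ v = spr A • v := by
  obtain ⟨r, x, hr, hx, hx0, hle, hmax⟩ := exists_max_superinvariant hA
  have hAx : A *ᵥ x = r • x := by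
    by_contra hne
    obtain ⟨P, hPA, hP⟩ := exists_commute_pos hA hirr
    set y := P *ᵥ x with hy
    have hypos : ∀ i, 0 < y i := mulVec_pos_of_pos hP hx hx0
    have hd : ∀ i, 0 < (A *ᵥ y - r • y) i := by
      have h : A *ᵥ y - r • y = P *ᵥ (A *ᵥ x - r • x) := by
        rw [hy, Matrix.mulVec_sub, Matrix.mulVec_smul, Matrix.mulVec_mulVec,
          Matrix.mulVec_mulVec, hPA.eq]
      rw [h]
      exact mulVec_pos_of_pos hP (sub_nonneg.2 hle) (sub_ne_zero.2 hne)
    -- The least ratio between the two positive vectors is the amount by which `r` can grow.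
    obtain ⟨i, hi⟩ := Finite.exists_min fun j => (A *ᵥ y - r • y) j / y j
    have hε : 0 < (A *ᵥ y - r • y) i / y i := div_pos (hd i) (hypos i)
    refine absurd (hmax (r + (A *ᵥ y - r • y) i / y i) y (fun j => (hypos j).le)
      (fun h => (hypos i).ne' (congrFun h i)) fun j => ?_) (by linarith)
    have hj := (le_div_iff₀ (hypos j)).1 (hi j)
    simp only [Pi.sub_apply, Pi.smul_apply, smul_eq_mul] at hj ⊢
    linarith
  rw [spr_eq_of_max hA hr hx0 hAx hmax]
  refine ⟨x, fun i => (hx i).lt_of_ne' fun hi => hx0 ?_, hAx⟩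
  exact eq_zero_of_mulVec_le hA hirr hr hx hAx.le hi

section MinMap

variable {K : Finset (Matrix (Fin N) (Fin N) ℝ)} {hK : K.Nonempty}

theorem minMap_le {A : Matrix (Fin N) (Fin N) ℝ} (hA : A ∈ K) (v : Fin N → ℝ) :
    minMap K hK v ≤ A *ᵥ v :=
  fun _ => Finset.inf'_le _ hA

/-- The product property lets finitely many rows be prescribed one at a time. -/
theorem ProductProperty.exists_rows (hprod : ProductProperty K) (hK : K.Nonempty)
    {F : Fin N → Matrix (Fin N) (Fin N) ℝ} (hF : ∀ i, F i ∈ K) (s : Finset (Fin N)) :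
    ∃ B ∈ K, ∀ i ∈ s, B i = F i i := by
  induction s using Finset.induction_on with
  | empty => exact hK.imp fun B hB => ⟨hB, by simp⟩
  | insert a s _ ih =>
    obtain ⟨B, hB, hBs⟩ := ih
    refine ⟨_, hprod {a} (F a) (hF a) B hB, fun i hi => ?_⟩
    by_cases hia : i = a
    · subst hia
      funext j
      simp
    · funext j
      simp [hia, hBs i (Finset.mem_of_mem_insert_of_ne hi hia)]

/-- Under the product property the componentwise minimum is attained by one member of `K`. -/
theorem ProductProperty.exists_minMap_eq (hprod : ProductProperty K) (hK : K.Nonempty)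
    (v : Fin N → ℝ) : ∃ B ∈ K, minMap K hK v = B *ᵥ v := by
  have h : ∀ i, ∃ A ∈ K, minMap K hK v i = (A *ᵥ v) i := fun i =>
    Finset.exists_mem_eq_inf' hK fun A => (A *ᵥ v) i
  choose F hF hFv using h
  obtain ⟨B, hB, hBF⟩ := hprod.exists_rows hK hF Finset.univ
  refine ⟨B, hB, funext fun i => ?_⟩
  rw [hFv i, Matrix.mulVec, Matrix.mulVec, hBF i (Finset.mem_univ i)]

end MinMap

end MinMatrix

theorem mainTheorem6 {N : ℕ} (hN : 1 ≤ N)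
    (K : Finset (Matrix (Fin N) (Fin N) ℝ)) (hK : K.Nonempty)
    (hnonneg : ∀ A ∈ K, MinMatrix.IsNonneg A)
    (hprod : MinMatrix.ProductProperty K)
    (hirr : ∀ A ∈ K, MinMatrix.Irreducible A) :
    ∃ v : Fin N → ℝ, (∀ i, 0 < v i) ∧
      MinMatrix.minMap K hK v = (K.inf' hK MinMatrix.spr) • v ∧
      ∀ u : Fin N → ℝ, MinMatrix.minMap K hK u = (K.inf' hK MinMatrix.spr) • u →
        ∃ c : ℝ, u = c • v := by
  have : NeZero N := ⟨by omega⟩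
  obtain ⟨A, hAK, hAr⟩ := Finset.exists_mem_eq_inf' hK MinMatrix.spr
  have hmin : ∀ B ∈ K, K.inf' hK MinMatrix.spr ≤ MinMatrix.spr B := fun B hB =>
    Finset.inf'_le _ hB
  have hr : 0 ≤ K.inf' hK MinMatrix.spr := hAr ▸ MinMatrix.spr_nonneg A
  obtain ⟨v, hv, hAv⟩ := MinMatrix.exists_pos_eigenvector (hnonneg A hAK) (hirr A hAK)
  rw [← hAr] at hAv
  generalize K.inf' hK MinMatrix.spr = r at *
  obtain ⟨B, hBK, hB⟩ := hprod.exists_minMap_eq hK v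
  have hBv_le : B *ᵥ v ≤ r • v := hB ▸ hAv ▸ MinMatrix.minMap_le hAK v
  have hBv : B *ᵥ v = r • v := by
    refine le_antisymm hBv_le ?_
    -- By minimality of `r`, the Perron vector `w` of `B` is superinvariant for `r`.
    obtain ⟨w, hw, hBw⟩ := MinMatrix.exists_pos_eigenvector (hnonneg B hBK) (hirr B hBK)
    have hrw : r • w ≤ B *ᵥ w := hBw ▸ fun i =>
      mul_le_mul_of_nonneg_right (hmin B hBK) (hw i).le
    obtain ⟨c, hc⟩ := MinMatrix.eq_smul_of_mulVec_le (hnonneg B hBK) (hirr B hBK) hr hv hBv_le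
      (fun i => (hw i).le) hrw
    have hc0 : 0 < c := by
      have := hw 0
      rw [hc] at this
      exact pos_of_mul_pos_left this (hv 0).le
    rw [hc, Matrix.mulVec_smul, smul_comm] at hrw
    exact (smul_le_smul_iff_of_pos_left hc0).1 hrw
  exact ⟨v, hv, hB.trans hBv, fun u hu =>
    MinMatrix.eq_smul_of_mulVec_eq (hnonneg B hBK) (hirr B hBK) hr hv hBv
      (hu ▸ MinMatrix.minMap_le hBK u)⟩
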